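/- Let $\alpha_0,\alpha_1,\alpha_2>-1$ be real numbers with $\alpha_1-\alpha_2\notin\mathbb Z$ and $|\alpha_1-\alpha_2|<1$. Consider the weights $w_1(x)=x^{\alpha_1}$, $w_2(x)=x^{\alpha_2}$ and the measure $\mathrm d\mu(x)=(1-x)^{\alpha_0}\,\mathrm dx$ on $[0,1]$ (the Jacobi--Piñeiro system). Put $\chi=(1,x,x^2,\dots)^\top$ and $\xi=(w_1,w_2,xw_1,xw_2,x^2w_1,x^2w_2,\dots)^\top$, let $g=\int_0^1\chi\,\xi^\top\,\mathrm d\mu$ be the moment matrix, and let $g=S^{-1}D\,\tilde S^{-\top}$ be its Gauss--Borel factorization ($S,\tilde S$ lower unitriangular, $D$ diagonal and invertible). Let $(B_n)_{n\ge0}$ be the entries of $S\chi$ (the monic type II Jacobi--Piñeiro multiple orthogonal polynomials on the step line), $(Q_n)_{n\ge0}$ the entries of $D^{-1}\tilde S\xi$ (the type I linear forms), and $H=S\Lambda S^{-1}$, where $\Lambda$ is the shift matrix with ones on the first superdiagonal and zeros elsewhere. The dual Jacobi--Piñeiro Markov chains are the Markov chains on $\{0,1,2,\dots\}$ with transition matrices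 $$\hat H_{nm}=\frac{B_m(1)}{B_n(1)}\,H_{nm},\qquad \check H_{nm}=\frac{Q_m(1)}{Q_n(1)}\,H_{mn}.$$ A Markov chain is called recurrent if, from every state, it returns to that state with probability $1$, and transient if, from every state, it returns to that state with probability less than $1$. Then $\hat H$ and $\check H$ are stochastic matrices. Both dual Markov chains are recurrent if $-1<\alpha_0\le 0$, and both are transient if $\alpha_0>0$. -/

import Mathlib

open Finset

noncomputable section

namespace JacobiPineiro

/-! ### Gauss--Borel factorization of a semi-infinite matrix -/

/-- The leading `n × n` block of a semi-infinite matrix. -/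
def leading (g : ℕ → ℕ → ℝ) (n : ℕ) : Matrix (Fin n) (Fin n) ℝ :=
  Matrix.of fun i j => g i j

/-- The left lower unitriangular factor `S` of `g = S⁻¹ D T⁻ᵀ`: its `n`-th row is
`(s, 1, 0, 0, …)`, where `s` solves `∑ i < n, s i * g i j = - g n j` for all `j < n`. -/
def gaussS (g : ℕ → ℕ → ℝ) (n k : ℕ) : ℝ :=
  if h : k < n then -(Matrix.vecMul (fun j : Fin n => g n j) (leading g n)⁻¹) ⟨k, h⟩
  else if k = n then 1 else 0

/-- The right lower unitriangular factor `T` of `g = S⁻¹ D T⁻ᵀ`. -/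
def gaussT (g : ℕ → ℕ → ℝ) : ℕ → ℕ → ℝ :=
  gaussS fun i j => g j i

/-- The diagonal factor `D` of `g = S⁻¹ D T⁻ᵀ`. -/
def gaussD (g : ℕ → ℕ → ℝ) (n : ℕ) : ℝ :=
  ∑ i ∈ range (n + 1), gaussS g n i * g i n

lemma gaussS_self (g : ℕ → ℕ → ℝ) (n : ℕ) : gaussS g n n = 1 := by
  simp [gaussS]

lemma gaussS_of_lt (g : ℕ → ℕ → ℝ) {n k : ℕ} (h : n < k) : gaussS g n k = 0 := by
  simp [gaussS, h.not_gt, h.ne']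

lemma gaussS_orthogonal (g : ℕ → ℕ → ℝ) {n j : ℕ} (hn : (leading g n).det ≠ 0) (hj : j < n) :
    ∑ i ∈ range (n + 1), gaussS g n i * g i j = 0 := by
  have hinv : (leading g n)⁻¹ * leading g n = 1 :=
    Matrix.nonsing_inv_mul _ (isUnit_iff_ne_zero.mpr hn)
  have h1 : ∑ i ∈ range n, gaussS g n i * g i j
      = -(Matrix.vecMul (Matrix.vecMul (fun j : Fin n => g n j) (leading g n)⁻¹)
          (leading g n)) ⟨j, hj⟩ := by
    rw [Finset.sum_range]
    simp only [Matrix.vecMul, dotProduct, ← Finset.sum_neg_distrib]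
    refine Finset.sum_congr rfl fun i _ => ?_
    simp [gaussS, leading, Matrix.vecMul, dotProduct]
  rw [Finset.sum_range_succ, h1, Matrix.vecMul_vecMul, hinv, Matrix.vecMul_one, gaussS_self]
  ring

/-- If all leading minors of `g` are nonzero, then `S g Tᵀ = D`. -/
lemma gauss_factorization (g : ℕ → ℕ → ℝ) (hg : ∀ n, (leading g n).det ≠ 0) (m n : ℕ) :
    ∑ i ∈ range (m + 1), ∑ j ∈ range (n + 1), gaussS g m i * g i j * gaussT g n j
      = if m = n then gaussD g n else 0 := by
  have hT : ∀ n i, i < n → ∑ j ∈ range (n + 1), gaussT g n j * g i j = 0 := by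
    intro n i hi
    refine gaussS_orthogonal (fun i j => g j i) ?_ hi
    have : leading (fun i j => g j i) n = (leading g n).transpose := rfl
    rw [this, Matrix.det_transpose]
    exact hg n
  have key : n ≤ m → ∑ i ∈ range (m + 1), ∑ j ∈ range (n + 1),
      gaussS g m i * g i j * gaussT g n j = if m = n then gaussD g n else 0 := by
    intro hnm
    rw [Finset.sum_comm]
    simp only [← Finset.sum_mul]
    rcases hnm.eq_or_lt with rfl | h
    · rw [Finset.sum_range_succ, Finset.sum_eq_zero fun j hj => ?_]
      · simp [gaussT, gaussS_self, gaussD]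
      · rw [gaussS_orthogonal g (hg n) (Finset.mem_range.mp hj), zero_mul]
    · rw [if_neg h.ne']
      refine Finset.sum_eq_zero fun j hj => ?_
      have : j < m := by have := Finset.mem_range.mp hj; omega
      rw [gaussS_orthogonal g (hg m) this, zero_mul]
  rcases le_or_gt n m with h | h
  · exact key h
  · rw [if_neg h.ne]
    refine Finset.sum_eq_zero fun i hi => ?_
    have hi' : i < n := by have := Finset.mem_range.mp hi; omega
    calc ∑ j ∈ range (n + 1), gaussS g m i * g i j * gaussT g n j
        = gaussS g m i * ∑ j ∈ range (n + 1), gaussT g n j * g i j := by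
          rw [Finset.mul_sum]
          exact Finset.sum_congr rfl fun j _ => by ring
      _ = 0 := by rw [hT n i hi', mul_zero]

/-- Inverse of a lower unitriangular semi-infinite matrix: row `n` of the inverse is the last row
of the inverse of the leading `(n + 1) × (n + 1)` block, followed by zeros. -/
def lowerInv (L : ℕ → ℕ → ℝ) (n k : ℕ) : ℝ :=
  if h : k ≤ n then (leading L (n + 1))⁻¹ (Fin.last n) ⟨k, Nat.lt_succ_of_le h⟩ else 0

/-- The Hessenberg matrix `S Λ S⁻¹`, with `Λ` the shift matrix (ones on the superdiagonal):
`(S Λ) n (k + 1) = S n k`. -/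
def hessenberg (g : ℕ → ℕ → ℝ) (n m : ℕ) : ℝ :=
  ∑ k ∈ range (n + 1), gaussS g n k * lowerInv (gaussS g) (k + 1) m

/-! ### The Jacobi--Piñeiro system: weights `x ^ α₁`, `x ^ α₂` and the measure
`(1 - x) ^ α₀ dx` on `[0, 1]` -/

/-- The entries `w₁, w₂, x w₁, x w₂, x² w₁, x² w₂, …` of the vector `ξ`. -/
def xi (α₁ α₂ : ℝ) (l : ℕ) (x : ℝ) : ℝ :=
  x ^ (l / 2) * (if l % 2 = 0 then x ^ α₁ else x ^ α₂)

/-- The moment matrix `∫ χ ξᵀ dμ`. -/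
def moment (α₀ α₁ α₂ : ℝ) (k l : ℕ) : ℝ :=
  ∫ x in (0 : ℝ)..1, x ^ k * xi α₁ α₂ l x * (1 - x) ^ α₀

/-- The monic type II multiple orthogonal polynomials on the step line. -/
def typeII (α₀ α₁ α₂ : ℝ) (n : ℕ) (x : ℝ) : ℝ :=
  ∑ k ∈ range (n + 1), gaussS (moment α₀ α₁ α₂) n k * x ^ k

/-- The type I linear forms `Q = D⁻¹ T ξ`. -/
def typeI (α₀ α₁ α₂ : ℝ) (n : ℕ) (x : ℝ) : ℝ :=
  (gaussD (moment α₀ α₁ α₂) n)⁻¹ *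
    ∑ l ∈ range (n + 1), gaussT (moment α₀ α₁ α₂) n l * xi α₁ α₂ l x

/-- The transition matrix of type II, `σ_II⁻¹ H σ_II` with `σ_II = diag (B_n(1))`. -/
def hatH (α₀ α₁ α₂ : ℝ) (n m : ℕ) : ℝ :=
  (typeII α₀ α₁ α₂ n 1)⁻¹ * hessenberg (moment α₀ α₁ α₂) n m * typeII α₀ α₁ α₂ m 1

/-- The dual transition matrix of type I, `σ_I⁻¹ Hᵀ σ_I` with `σ_I = diag (Q_n(1))`. -/
def checkH (α₀ α₁ α₂ : ℝ) (n m : ℕ) : ℝ :=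
  (typeI α₀ α₁ α₂ n 1)⁻¹ * hessenberg (moment α₀ α₁ α₂) m n * typeI α₀ α₁ α₂ m 1

/-! ### Recurrence and transience of a Markov chain with state space `ℕ` -/

/-- `P` is a (row) stochastic matrix. -/
def IsStochastic (P : ℕ → ℕ → ℝ) : Prop :=
  (∀ i j, 0 ≤ P i j) ∧ ∀ i, HasSum (P i) 1

/-- For a Markov chain `X` with transition matrix `P`, the probability
`ℙ (X (n + 1) = j, X r ≠ j for 1 ≤ r ≤ n | X 0 = i)` that the first visit to `j` after time `0`
happens at time `n + 1` (one-step analysis: the first step leads to a state `k ≠ j`). -/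
def firstPassage (P : ℕ → ℕ → ℝ) : ℕ → ℕ → ℕ → ℝ
  | 0, i, j => P i j
  | n + 1, i, j => ∑' k, if k = j then 0 else P i k * firstPassage P n k j

/-- The chain is recurrent: from every state it returns to that state with probability `1`. -/
def IsRecurrent (P : ℕ → ℕ → ℝ) : Prop :=
  IsStochastic P ∧ ∀ i, HasSum (fun n => firstPassage P n i i) 1

/-- The chain is transient: from every state it returns to that state with probability `< 1`. -/
def IsTransient (P : ℕ → ℕ → ℝ) : Prop :=
  IsStochastic P ∧ ∀ i, ∃ p : ℝ, p < 1 ∧ HasSum (fun n => firstPassage P n i i) p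

end JacobiPineiro

end

noncomputable section

namespace JacobiPineiro

open Filter Topology ProbabilityTheory

/-! ### The beta function -/

/-! Put `a = α₀ + 1` and let `x ^ (c l - 1)` be the entries of `ξ`, so that `c (l + 2) = c l + 1`.
All moments are beta values `B(c l + k, a)`. By biorthogonality, `∫ xᵏ B_i Q_j dμ` is the `(i, j)`
entry of `Hᵏ` (`pairing_zero`, `pairing_succ`). Both chains are diagonal conjugates of `H` or of its
transpose, so both have `n`-step return probability `∫ xⁿ B_i Q_i dμ`. The measure near `x = 1`
decides its decay: it is asymptotic to `B_i(1) Q_i(1) Γ(a) n ^ (-a)` (`tendsto_rpow_mul_pairing`),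
which is summable exactly when `1 < a`. The renewal equation turns summability into transience and
divergence into recurrence.

It remains to see that the matrices are stochastic. Row sums are the recurrence relations evaluated
at `x = 1`. For signs, take Mellin transforms: up to a constant, orthogonality forces the transform
of `B_n` to be `Γ(s) / Γ(s + a + n) * ∏ l < n, (s - c l)`, and multiplication by `x` becomes `s ↦ s
+ 1`. Hence the entries of the type II matrix are the connection coefficients expressing the `n`-th
such function at `s + 1` through those at `s`. After removal of common factors they are the
coefficients of a cubic in a mixed Newton-type basis, nonnegative by monotonicity of rational
functions (`exists_nonneg_cubic_expansion`); here `|α₁ - α₂| < 1` enters. Comparison at one point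
gives `B_n(1) > 0`, and the asymptotics together with the recurrence give `Q_n(1) > 0`. -/

lemma integral_rpow_mul_one_sub_rpow {u v : ℝ} (hu : 0 < u) (hv : 0 < v) :
    ∫ x in (0 : ℝ)..1, x ^ (u - 1) * (1 - x) ^ (v - 1) = beta u v := by
  rw [beta_eq_betaIntegralReal u v hu hv, Complex.betaIntegral]
  have : ∫ x in (0 : ℝ)..1, (x : ℂ) ^ ((u : ℂ) - 1) * (1 - (x : ℂ)) ^ ((v : ℂ) - 1)
      = ∫ x in (0 : ℝ)..1, ((x ^ (u - 1) * (1 - x) ^ (v - 1) : ℝ) : ℂ) := by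
    refine intervalIntegral.integral_congr fun x hx => ?_
    rw [Set.uIcc_of_le zero_le_one] at hx
    push_cast
    rw [Complex.ofReal_cpow hx.1, Complex.ofReal_cpow (sub_nonneg.mpr hx.2)]
    push_cast
    rfl
  rw [this, intervalIntegral.integral_ofReal, Complex.ofReal_re]

lemma Gamma_add_nat {s : ℝ} (hs : 0 < s) (n : ℕ) :
    Real.Gamma (s + n) = Real.Gamma s * ∏ j ∈ range n, (s + j) := by
  induction n with
  | zero => simp
  | succ n ih =>
    rw [prod_range_succ, ← mul_assoc, ← ih, Nat.cast_succ, ← add_assoc,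
      Real.Gamma_add_one (by positivity), mul_comm]

lemma GammaSeq_eq {s : ℝ} (hs : 0 < s) (n : ℕ) :
    Real.GammaSeq s n
      = (n : ℝ) ^ s * n.factorial * Real.Gamma s / Real.Gamma (s + (n + 1 : ℕ)) := by
  have h := (Real.Gamma_pos_of_pos hs).ne'
  rw [Real.GammaSeq, Gamma_add_nat hs, mul_comm (Real.Gamma s), mul_div_mul_right _ _ h]

/-- `B(c + n, a) ~ Γ(a) n ^ (-a)` as `n → ∞`. -/
lemma tendsto_rpow_mul_beta {c a : ℝ} (hc : 0 < c) (ha : 0 < a) :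
    Tendsto (fun n : ℕ => (n : ℝ) ^ a * beta (n + c) a) atTop (𝓝 (Real.Gamma a)) := by
  have hΓ : ∀ {s : ℝ}, 0 < s → Real.Gamma s ≠ 0 := fun hs => (Real.Gamma_pos_of_pos hs).ne'
  have h1 : Tendsto (fun n : ℕ => (n : ℝ) ^ a * beta ((n + 1 : ℕ) + c) a) atTop
      (𝓝 (Real.Gamma a)) := by
    -- Euler's limit formula: the beta value is a quotient of two `GammaSeq` terms. `GammaSeq s n`
    -- has `n + 1` factors in its denominator, hence the index `n + 1` here, undone afterwards by
    -- the factor `((n + 1) / n) ^ a → 1`.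
    have key := ((Real.GammaSeq_tendsto_Gamma (c + a)).div (Real.GammaSeq_tendsto_Gamma c)
      (hΓ hc)).const_mul (Real.Gamma a * Real.Gamma c / Real.Gamma (c + a))
    have hlim : Real.Gamma a * Real.Gamma c / Real.Gamma (c + a)
        * (Real.Gamma (c + a) / Real.Gamma c) = Real.Gamma a := by
      have := hΓ hc
      have := hΓ (add_pos hc ha)
      field_simp
    rw [hlim] at key
    refine key.congr' ?_
    filter_upwards [eventually_gt_atTop 0] with n hn
    have hn' : (0 : ℝ) < n := by exact_mod_cast hn
    simp only [Pi.div_apply]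
    rw [GammaSeq_eq hc, GammaSeq_eq (add_pos hc ha), beta, Real.rpow_add hn']
    have e1 : ((n + 1 : ℕ) : ℝ) + c = c + (n + 1 : ℕ) := add_comm _ _
    have e2 : c + ((n + 1 : ℕ) : ℝ) + a = c + a + (n + 1 : ℕ) := by ring
    rw [e1, e2]
    have f1 := hΓ hc
    have f2 := hΓ (add_pos hc ha)
    have f3 : Real.Gamma (c + (n + 1 : ℕ)) ≠ 0 := hΓ (by positivity)
    have f4 : Real.Gamma (c + a + (n + 1 : ℕ)) ≠ 0 := hΓ (by positivity)
    have f5 : (n.factorial : ℝ) ≠ 0 := by positivity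
    have f6 := (Real.rpow_pos_of_pos hn' c).ne'
    field_simp
  rw [← tendsto_add_atTop_iff_nat 1]
  have h2 : Tendsto (fun n : ℕ => (((n + 1 : ℕ) : ℝ) / n) ^ a) atTop (𝓝 1) := by
    have h3 : Tendsto (fun n : ℕ => ((n + 1 : ℕ) : ℝ) / n) atTop (𝓝 1) := by
      have := (tendsto_natCast_div_add_atTop (1 : ℝ)).inv₀ one_ne_zero
      simpa using this
    simpa using h3.rpow_const (p := a) (Or.inl one_ne_zero)
  have h4 := h2.mul h1
  rw [one_mul] at h4
  refine h4.congr' ?_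
  filter_upwards [eventually_gt_atTop 0] with n hn
  have hn' : (0 : ℝ) < n := by exact_mod_cast hn
  rw [Real.div_rpow (by positivity) hn'.le]
  have f6 := (Real.rpow_pos_of_pos hn' a).ne'
  field_simp

/-- A sequence asymptotic to a positive multiple of `n ^ (-a)` is summable iff `1 < a`. -/
lemma summable_iff_of_tendsto_rpow_mul {u : ℕ → ℝ} {a L : ℝ} (hL : 0 < L)
    (hu : Tendsto (fun n : ℕ => (n : ℝ) ^ a * u n) atTop (𝓝 L)) : Summable u ↔ 1 < a := by
  have heq : u =Θ[atTop] fun n : ℕ => (n : ℝ) ^ (-a) := by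
    have h1 : (fun n : ℕ => (n : ℝ) ^ a * u n) =Θ[atTop] fun _ => (1 : ℝ) :=
      (Asymptotics.isTheta_of_div_tendsto_nhds_ne_zero (c := L)
        (by simpa only [Pi.div_apply, div_one] using hu) hL.ne').symm
    have h2 := (Asymptotics.isTheta_refl (fun n : ℕ => (n : ℝ) ^ (-a)) atTop).mul h1
    simp only [mul_one] at h2
    refine Asymptotics.IsTheta.trans (Filter.EventuallyEq.isTheta ?_) h2
    filter_upwards [eventually_gt_atTop 0] with n hn
    have hn' : (0 : ℝ) < n := by exact_mod_cast hn
    rw [← mul_assoc, ← Real.rpow_add hn']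
    simp
  rw [heq.summable_iff_nat, Real.summable_nat_rpow]
  constructor <;> intro h <;> linarith

/-! ### Renewal theory for chains with finite-range transitions -/

/-- Powers of a matrix whose `i`-th row vanishes beyond column `i + 2`. -/
def bandPow (P : ℕ → ℕ → ℝ) : ℕ → ℕ → ℕ → ℝ
  | 0, i, j => if i = j then 1 else 0
  | n + 1, i, j => ∑ m ∈ range (i + 3), P i m * bandPow P n m j

section
variable {P : ℕ → ℕ → ℝ}

lemma isStochastic_of_band (h0 : ∀ i j, 0 ≤ P i j) (hb : ∀ i j, i + 3 ≤ j → P i j = 0)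
    (h1 : ∀ i, ∑ j ∈ range (i + 3), P i j = 1) : IsStochastic P := by
  refine ⟨h0, fun i => ?_⟩
  rw [← h1 i]
  exact hasSum_sum_of_ne_finset_zero fun j hj => hb i j (by simpa using hj)

lemma firstPassage_succ_eq_sum (hb : ∀ i j, i + 3 ≤ j → P i j = 0) (n i j : ℕ) :
    firstPassage P (n + 1) i j
      = ∑ k ∈ range (i + 3), if k = j then 0 else P i k * firstPassage P n k j := by
  rw [firstPassage]
  refine tsum_eq_sum fun k hk => ?_
  rw [hb i k (by simpa using hk)]
  simp

lemma firstPassage_nonneg (h0 : ∀ i j, 0 ≤ P i j) (n i j : ℕ) : 0 ≤ firstPassage P n i j := by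
  induction n generalizing i with
  | zero => exact h0 i j
  | succ n ih =>
    rw [firstPassage]
    refine tsum_nonneg fun k => ?_
    split_ifs
    exacts [le_rfl, mul_nonneg (h0 _ _) (ih k)]

lemma bandPow_nonneg (h0 : ∀ i j, 0 ≤ P i j) (n i j : ℕ) : 0 ≤ bandPow P n i j := by
  induction n generalizing i with
  | zero => rw [bandPow]; split_ifs <;> norm_num
  | succ n ih =>
    rw [bandPow]
    exact sum_nonneg fun k _ => mul_nonneg (h0 _ _) (ih k)

/-- Splitting a row sum at the column `j`. -/
lemma sum_band_eq_add (hb : ∀ i j, i + 3 ≤ j → P i j = 0) (i j : ℕ) (f : ℕ → ℝ) :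
    ∑ k ∈ range (i + 3), P i k * f k
      = P i j * f j + ∑ k ∈ range (i + 3), if k = j then 0 else P i k * f k := by
  have h : P i j * f j = ∑ k ∈ range (i + 3), if k = j then P i k * f k else 0 := by
    rw [Finset.sum_ite_eq']
    split_ifs with hj
    · rfl
    · rw [hb i j (by simpa using hj), zero_mul]
  rw [h, ← sum_add_distrib]
  refine sum_congr rfl fun k _ => ?_
  split_ifs <;> simp

/-- Induction on the time horizon, conditioning on the first step: either it hits `j`, or the bound
holds from the state reached. -/
lemma sum_firstPassage_le_one (h0 : ∀ i j, 0 ≤ P i j) (hb : ∀ i j, i + 3 ≤ j → P i j = 0)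
    (h1 : ∀ i, ∑ j ∈ range (i + 3), P i j = 1) (N i j : ℕ) :
    ∑ n ∈ range N, firstPassage P n i j ≤ 1 := by
  induction N generalizing i with
  | zero => simp
  | succ N ih =>
    rw [sum_range_succ']
    have h : ∑ n ∈ range N, firstPassage P (n + 1) i j
        = ∑ k ∈ range (i + 3),
          if k = j then 0 else P i k * ∑ n ∈ range N, firstPassage P n k j := by
      simp_rw [firstPassage_succ_eq_sum hb]
      rw [sum_comm]
      refine sum_congr rfl fun k _ => ?_
      split_ifs
      · simp
      · rw [mul_sum]
    have h2 := sum_band_eq_add hb i j fun _ => 1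
    simp only [mul_one, h1] at h2
    rw [h, h2, firstPassage, add_comm]
    gcongr with k
    split_ifs
    · exact le_rfl
    · exact mul_le_of_le_one_right (h0 _ _) (ih k)

/-- The renewal equation. -/
lemma bandPow_succ_eq_sum (hb : ∀ i j, i + 3 ≤ j → P i j = 0) (n i j : ℕ) :
    bandPow P (n + 1) i j
      = ∑ r ∈ range (n + 1), firstPassage P r i j * bandPow P (n - r) j j := by
  induction n generalizing i with
  | zero =>
    have h : ∑ k ∈ range (i + 3), (if k = j then 0 else P i k * bandPow P 0 k j) = 0 := by
      refine sum_eq_zero fun k _ => ?_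
      split_ifs with hk
      · rfl
      · simp [bandPow, hk]
    rw [bandPow, sum_band_eq_add hb i j, h]
    simp [firstPassage, bandPow]
  | succ n ih =>
    rw [bandPow, sum_band_eq_add hb i j,
      sum_range_succ' (fun r => firstPassage P r i j * bandPow P (n + 1 - r) j j) (n + 1),
      add_comm (P i j * _)]
    congr 1
    simp_rw [firstPassage_succ_eq_sum hb, Finset.sum_mul]
    rw [sum_comm]
    refine sum_congr rfl fun k _ => ?_
    split_ifs
    · simp
    · rw [ih k, mul_sum]
      refine sum_congr rfl fun r _ => ?_
      rw [Nat.succ_sub_succ, mul_assoc]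

lemma bandPow_eq_antidiagonal (hb : ∀ i j, i + 3 ≤ j → P i j = 0) (n j : ℕ) :
    bandPow P (n + 1) j j
      = ∑ p ∈ antidiagonal n, firstPassage P p.1 j j * bandPow P p.2 j j := by
  rw [bandPow_succ_eq_sum hb, Nat.sum_antidiagonal_eq_sum_range_succ
    fun r s => firstPassage P r j j * bandPow P s j j]

lemma summable_firstPassage (h0 : ∀ i j, 0 ≤ P i j) (hb : ∀ i j, i + 3 ≤ j → P i j = 0)
    (h1 : ∀ i, ∑ j ∈ range (i + 3), P i j = 1) (i : ℕ) :
    Summable fun n => firstPassage P n i i :=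
  summable_of_sum_range_le (fun n => firstPassage_nonneg h0 n i i)
    fun N => sum_firstPassage_le_one h0 hb h1 N i i

/-- With `U` the sum of return probabilities and `F` that of first-return probabilities, the Cauchy
product of the renewal equation gives `U - 1 = F * U`; since `U` is finite and at least `1`, `F <
1`. -/
lemma isTransient_of_summable (h0 : ∀ i j, 0 ≤ P i j) (hb : ∀ i j, i + 3 ≤ j → P i j = 0)
    (h1 : ∀ i, ∑ j ∈ range (i + 3), P i j = 1)
    (hs : ∀ i, Summable fun n => bandPow P n i i) : IsTransient P := by
  refine ⟨isStochastic_of_band h0 hb h1, fun i => ?_⟩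
  have hf := summable_firstPassage h0 hb h1 i
  refine ⟨_, ?_, hf.hasSum⟩
  have hprod := tsum_mul_tsum_eq_tsum_sum_antidiagonal_of_summable_norm hf.norm (hs i).norm
  simp_rw [← bandPow_eq_antidiagonal hb] at hprod
  have hsplit := (hs i).tsum_eq_zero_add
  have hz : bandPow P 0 i i = 1 := by simp [bandPow]
  have hU : 0 ≤ ∑' n, bandPow P (n + 1) i i := tsum_nonneg fun n => bandPow_nonneg h0 _ _ _
  rw [hz] at hsplit
  nlinarith

/-- If the return probability `F` were below `1`, the partial sums `U_N` would satisfy `U_N ≤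
U_(N+1) ≤ F * U_N + 1`, hence `U_N ≤ 1 / (1 - F)`, contradicting divergence. -/
lemma isRecurrent_of_not_summable (h0 : ∀ i j, 0 ≤ P i j) (hb : ∀ i j, i + 3 ≤ j → P i j = 0)
    (h1 : ∀ i, ∑ j ∈ range (i + 3), P i j = 1)
    (hs : ∀ i, ¬ Summable fun n => bandPow P n i i) : IsRecurrent P := by
  refine ⟨isStochastic_of_band h0 hb h1, fun i => ?_⟩
  have hf := summable_firstPassage h0 hb h1 i
  have hle : ∑' n, firstPassage P n i i ≤ 1 :=
    hf.tsum_le_of_sum_range_le fun N => sum_firstPassage_le_one h0 hb h1 N i i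
  suffices ∑' n, firstPassage P n i i = 1 by rw [← this]; exact hf.hasSum
  by_contra hne
  have hlt := lt_of_le_of_ne hle hne
  set F := ∑' n, firstPassage P n i i with hF
  refine hs i (summable_of_sum_range_le (c := (1 - F)⁻¹) (fun n => bandPow_nonneg h0 n i i)
    fun N => ?_)
  have hF0 : ∀ N, ∑ n ∈ range N, firstPassage P n i i ≤ F := fun N =>
    hf.sum_le_tsum _ fun n _ => firstPassage_nonneg h0 n i i
  have hmono : ∀ N M, N ≤ M → ∑ n ∈ range N, bandPow P n i i ≤ ∑ n ∈ range M, bandPow P n i i :=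
    fun N M h => sum_le_sum_of_subset_of_nonneg (range_mono h)
      fun n _ _ => bandPow_nonneg h0 n i i
  have hU0 : 0 ≤ ∑ n ∈ range N, bandPow P n i i := sum_nonneg fun n _ => bandPow_nonneg h0 n i i
  have key : ∑ n ∈ range (N + 1), bandPow P n i i
      ≤ F * ∑ n ∈ range N, bandPow P n i i + 1 := by
    rw [sum_range_succ']
    have hz : bandPow P 0 i i = 1 := by simp [bandPow]
    rw [hz]
    gcongr
    simp_rw [bandPow_succ_eq_sum hb]
    rw [Finset.sum_range_diag_flip N fun r s => firstPassage P r i i * bandPow P s i i]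
    calc ∑ r ∈ range N, ∑ s ∈ range (N - r), firstPassage P r i i * bandPow P s i i
        ≤ ∑ r ∈ range N, firstPassage P r i i * ∑ s ∈ range N, bandPow P s i i := by
          refine sum_le_sum fun r _ => ?_
          rw [← mul_sum]
          exact mul_le_mul_of_nonneg_left (hmono _ _ (Nat.sub_le N r))
            (firstPassage_nonneg h0 r i i)
      _ ≤ F * ∑ s ∈ range N, bandPow P s i i := by
          rw [← sum_mul]
          exact mul_le_mul_of_nonneg_right (hF0 N) hU0
  have := hmono N (N + 1) (Nat.le_succ N)
  rw [← one_div, le_div_iff₀ (by linarith)]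
  linarith
end

/-! ### Gauss--Borel algebra -/

/-- Application of row `n` of the lower triangular matrix `L` to a vector. -/
def lowerApply (L : ℕ → ℕ → ℝ) (n : ℕ) (f : ℕ → ℝ) : ℝ :=
  ∑ k ∈ range (n + 1), L n k * f k

lemma lowerInv_of_lt (L : ℕ → ℕ → ℝ) {n k : ℕ} (h : n < k) : lowerInv L n k = 0 := by
  simp [lowerInv, h.not_ge]

lemma lowerApply_eq_sum_range {L : ℕ → ℕ → ℝ} (hL : ∀ n k, n < k → L n k = 0) {n N : ℕ}
    (h : n < N) (f : ℕ → ℝ) : lowerApply L n f = ∑ k ∈ range N, L n k * f k := by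
  refine sum_subset (range_mono h) fun k _ hk => ?_
  rw [hL n k (by simpa using hk), zero_mul]

lemma det_leading_of_unitriangular {L : ℕ → ℕ → ℝ} (h1 : ∀ n, L n n = 1)
    (hL : ∀ n k, n < k → L n k = 0) (n : ℕ) : (leading L n).det = 1 := by
  rw [Matrix.det_of_isLowerTriangular (leading L n) fun i j hij => hL i j hij]
  simp [leading, h1]

lemma lowerInv_mul {L : ℕ → ℕ → ℝ} (h1 : ∀ n, L n n = 1) (hL : ∀ n k, n < k → L n k = 0)
    {n j : ℕ} (hj : j ≤ n) :
    ∑ m ∈ range (n + 1), lowerInv L n m * L m j = if j = n then 1 else 0 := by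
  have hinv : (leading L (n + 1))⁻¹ * leading L (n + 1) = 1 :=
    Matrix.nonsing_inv_mul _ (by simp [det_leading_of_unitriangular h1 hL])
  have h := congrFun (congrFun hinv (Fin.last n)) ⟨j, Nat.lt_succ_of_le hj⟩
  rw [Matrix.mul_apply, Matrix.one_apply] at h
  rw [Finset.sum_range]
  convert h using 1
  · refine sum_congr rfl fun m _ => ?_
    simp [lowerInv, leading, Nat.le_of_lt_succ m.2]
  · simp [Fin.ext_iff, eq_comm]

lemma lowerInv_lowerApply {L : ℕ → ℕ → ℝ} (h1 : ∀ n, L n n = 1) (hL : ∀ n k, n < k → L n k = 0)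
    (n : ℕ) (f : ℕ → ℝ) :
    ∑ m ∈ range (n + 1), lowerInv L n m * lowerApply L m f = f n := by
  calc ∑ m ∈ range (n + 1), lowerInv L n m * lowerApply L m f
      = ∑ m ∈ range (n + 1), ∑ j ∈ range (n + 1), lowerInv L n m * L m j * f j := by
        refine sum_congr rfl fun m hm => ?_
        rw [lowerApply_eq_sum_range hL (mem_range.mp hm), mul_sum]
        exact sum_congr rfl fun j _ => (mul_assoc _ _ _).symm
    _ = ∑ j ∈ range (n + 1), (if j = n then 1 else 0) * f j := by
        rw [sum_comm]
        refine sum_congr rfl fun j hj => ?_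
        rw [← sum_mul, lowerInv_mul h1 hL (Nat.le_of_lt_succ (mem_range.mp hj))]
    _ = f n := by simp

section
variable (g : ℕ → ℕ → ℝ)

lemma gaussT_self (n : ℕ) : gaussT g n n = 1 := gaussS_self _ n

lemma gaussT_of_lt (n k : ℕ) (h : n < k) : gaussT g n k = 0 := gaussS_of_lt _ h

/-- The linear functional given by row `n` of `D⁻¹ T`. -/
def dualApply (n : ℕ) (f : ℕ → ℝ) : ℝ :=
  (gaussD g n)⁻¹ * lowerApply (gaussT g) n f

lemma hessenberg_of_lt {n m : ℕ} (h : n + 1 < m) : hessenberg g n m = 0 := by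
  refine sum_eq_zero fun k hk => ?_
  have := mem_range.mp hk
  rw [lowerInv_of_lt _ (by omega), mul_zero]

lemma sum_hessenberg_mul_lowerApply (n : ℕ) (f : ℕ → ℝ) :
    ∑ m ∈ range (n + 2), hessenberg g n m * lowerApply (gaussS g) m f
      = lowerApply (gaussS g) n fun k => f (k + 1) := by
  simp_rw [hessenberg, sum_mul]
  rw [sum_comm]
  refine sum_congr rfl fun k hk => ?_
  have hk' : k + 1 + 1 ≤ n + 2 := by have := mem_range.mp hk; omega
  simp_rw [mul_assoc]
  rw [← mul_sum, ← lowerInv_lowerApply (gaussS_self g) (fun _ _ h => gaussS_of_lt g h) (k + 1) f]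
  congr 1
  symm
  refine sum_subset (range_mono hk') fun m _ hm => ?_
  rw [lowerInv_of_lt _ (by simpa using hm), zero_mul]

lemma hessenberg_succ (n : ℕ) : hessenberg g n (n + 1) = 1 := by
  have hS := @lowerInv_mul (gaussS g) (gaussS_self g) (fun _ _ h => gaussS_of_lt g h)
  have h1 : ∀ m, lowerInv (gaussS g) m m = 1 := fun m => by
    have h := hS (le_refl m)
    rw [sum_range_succ, sum_eq_zero, gaussS_self, if_pos rfl] at h
    · simpa using h
    · intro k hk
      rw [gaussS_of_lt g (mem_range.mp hk), mul_zero]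
  rw [hessenberg, sum_range_succ, sum_eq_zero, gaussS_self, h1]
  · simp
  · intro k hk
    have := mem_range.mp hk
    rw [lowerInv_of_lt _ (by omega), mul_zero]

/-- The pairing `∫ xᵏ B_i Q_j dμ`. -/
def pairing (k i j : ℕ) : ℝ :=
  lowerApply (gaussS g) i fun m => dualApply g j fun l => g (m + k) l

/-- Multiplication by `x` acts on the type II side through `H`; iterated from `pairing_zero`, this
makes `pairing g k` the `k`-th power of `H`. -/
lemma pairing_succ (k i j : ℕ) :
    pairing g (k + 1) i j = ∑ m ∈ range (i + 2), hessenberg g i m * pairing g k m j := by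
  simp only [pairing]
  rw [sum_hessenberg_mul_lowerApply g i fun m => dualApply g j fun l => g (m + k) l]
  simp only [add_right_comm, add_assoc, add_comm k 1]

variable {g}

lemma dualApply_sum (n : ℕ) (s : Finset ℕ) (r : ℕ → ℝ) (F : ℕ → ℕ → ℝ) :
    dualApply g n (fun l => ∑ m ∈ s, r m * F m l) = ∑ m ∈ s, r m * dualApply g n (F m) := by
  simp only [dualApply, lowerApply, mul_sum]
  rw [sum_comm]
  refine sum_congr rfl fun m _ => sum_congr rfl fun l _ => by ring

lemma lowerApply_dualApply_comm (L : ℕ → ℕ → ℝ) (i j : ℕ) (F : ℕ → ℕ → ℝ) :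
    lowerApply L i (fun m => dualApply g j (F m))
      = dualApply g j fun l => lowerApply L i fun m => F m l :=
  (dualApply_sum j _ _ F).symm

lemma pairing_zero (hg : ∀ n, (leading g n).det ≠ 0) (hD : ∀ n, gaussD g n ≠ 0) (i j : ℕ) :
    pairing g 0 i j = if i = j then 1 else 0 := by
  have h := gauss_factorization g hg i j
  have h2 : pairing g 0 i j = (gaussD g j)⁻¹ *
      ∑ k ∈ range (i + 1), ∑ l ∈ range (j + 1), gaussS g i k * g k l * gaussT g j l := by
    simp only [pairing, lowerApply, dualApply, add_zero, mul_sum]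
    exact sum_congr rfl fun k _ => sum_congr rfl fun l _ => by ring
  rw [h2, h]
  split_ifs
  · exact inv_mul_cancel₀ (hD j)
  · simp

lemma exists_eq_sum_dualApply (hD : ∀ n, gaussD g n ≠ 0) (l N : ℕ) (hl : l < N) :
    ∃ r : ℕ → ℝ, ∀ f, f l = ∑ m ∈ range N, r m * dualApply g m f := by
  refine ⟨fun m => lowerInv (gaussT g) l m * gaussD g m, fun f => ?_⟩
  rw [← lowerInv_lowerApply (gaussT_self g) (gaussT_of_lt g) l f]
  rw [sum_subset (range_mono (Nat.succ_le_of_lt hl))]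
  · refine sum_congr rfl fun m _ => ?_
    rw [dualApply, mul_assoc, mul_inv_cancel_left₀ (hD m)]
  · intro m _ hm
    rw [lowerInv_of_lt _ (by simpa using hm), zero_mul]

/-- The shifted functional sees only the coordinates up to `j + 2`, and these are spanned by rows
`0` to `j + 2` of `D⁻¹ T`. The coefficients are identified afterwards. -/
lemma exists_dualApply_shift (hD : ∀ n, gaussD g n ≠ 0) (j : ℕ) :
    ∃ r : ℕ → ℝ, ∀ f, dualApply g j (fun l => f (l + 2))
      = ∑ m ∈ range (j + 3), r m * dualApply g m f := by
  have h : ∀ l, ∃ r : ℕ → ℝ, l < j + 1 → ∀ f : ℕ → ℝ,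
      f (l + 2) = ∑ m ∈ range (j + 3), r m * dualApply g m f := fun l => by
    by_cases hl : l < j + 1
    · obtain ⟨r, hr⟩ := exists_eq_sum_dualApply hD (l + 2) (j + 3) (by omega)
      exact ⟨r, fun _ => hr⟩
    · exact ⟨0, fun h => absurd h hl⟩
  choose r hr using h
  refine ⟨fun m => dualApply g j fun l => r l m, fun f => ?_⟩
  have h : dualApply g j (fun l => f (l + 2))
      = dualApply g j fun l => ∑ m ∈ range (j + 3), dualApply g m f * r l m := by
    refine congrArg ((gaussD g j)⁻¹ * ·) (sum_congr rfl fun l hl => ?_)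
    beta_reduce
    rw [hr l (mem_range.mp hl) f]
    simp only [mul_comm]
  rw [h, dualApply_sum j _ _ fun m l => r l m]
  simp only [mul_comm]

variable (hg : ∀ n, (leading g n).det ≠ 0) (hD : ∀ n, gaussD g n ≠ 0)
  (hshift : ∀ k l, g (k + 1) l = g k (l + 2))
include hg hD

lemma pairing_one (i j : ℕ) : pairing g 1 i j = hessenberg g i j := by
  rw [pairing_succ]
  simp only [pairing_zero hg hD, mul_ite, mul_one, mul_zero, sum_ite_eq', mem_range]
  split_ifs with h
  · rfl
  · rw [hessenberg_of_lt g (by omega)]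

include hshift

/-- Multiplication by `x` moves `ξ` by two places. Pairing the expansion of the shifted functional
with the rows of `S` and using biorthogonality shows that its coefficients are column `j` of `H`, so
this column ends at row `j + 2`. -/
lemma exists_shift_coeff (j : ℕ) :
    (∀ m, j + 3 ≤ m → hessenberg g m j = 0) ∧ ∀ f, dualApply g j (fun l => f (l + 2))
      = ∑ m ∈ range (j + 3), hessenberg g m j * dualApply g m f := by
  obtain ⟨r, hr⟩ := exists_dualApply_shift hD j
  have key : ∀ i, hessenberg g i j = if i < j + 3 then r i else 0 := fun i => by
    rw [← pairing_one hg hD, pairing, lowerApply_dualApply_comm]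
    simp only [hshift]
    rw [hr fun l => lowerApply (gaussS g) i fun m => g m l]
    have h0 : ∀ m, dualApply g m (fun l => lowerApply (gaussS g) i fun k => g k l)
        = if i = m then 1 else 0 := fun m => by
      rw [← lowerApply_dualApply_comm, ← pairing_zero hg hD]
      rfl
    simp [h0]
  refine ⟨fun m hm => by rw [key, if_neg (by omega)], fun f => ?_⟩
  rw [hr f]
  refine sum_congr rfl fun m hm => ?_
  rw [key, if_pos (mem_range.mp hm)]

lemma hessenberg_of_add_three_le {m j : ℕ} (h : j + 3 ≤ m) : hessenberg g m j = 0 :=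
  (exists_shift_coeff hg hD hshift j).1 m h

lemma sum_hessenberg_mul_dualApply (j : ℕ) (f : ℕ → ℝ) :
    ∑ m ∈ range (j + 3), hessenberg g m j * dualApply g m f
      = dualApply g j fun l => f (l + 2) :=
  ((exists_shift_coeff hg hD hshift j).2 f).symm

lemma pairing_succ' (k i j : ℕ) :
    pairing g (k + 1) i j = ∑ m ∈ range (j + 3), hessenberg g m j * pairing g k i m := by
  simp only [pairing, lowerApply_dualApply_comm]
  rw [sum_hessenberg_mul_dualApply hg hD hshift]
  simp only [← add_assoc, hshift]

end

open Polynomial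

/-! ### Beta transforms of polynomials -/

/-- The polynomial `p` with `∑ k ≤ n, v k * B(s + k, a) = p(s) Γ(s) Γ(a) / Γ(s + a + n)`. -/
def mellinPoly (a : ℝ) (v : ℕ → ℝ) : ℕ → ℝ[X]
  | 0 => C (v 0)
  | n + 1 => mellinPoly a v n * (X + C (n + a)) + C (v (n + 1)) * ascPochhammer ℝ (n + 1)

lemma eval_ascPochhammer_eq_prod (s : ℝ) (n : ℕ) :
    (ascPochhammer ℝ n).eval s = ∏ j ∈ range n, (s + j) := by
  induction n with
  | zero => simp
  | succ n ih => rw [ascPochhammer_succ_eval, ih, prod_range_succ]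

section
variable {a : ℝ} (v : ℕ → ℝ)

lemma sum_mul_beta (ha : 0 < a) {s : ℝ} (hs : 0 < s) (n : ℕ) :
    ∑ k ∈ range (n + 1), v k * beta (s + k) a
      = (mellinPoly a v n).eval s * Real.Gamma s * Real.Gamma a / Real.Gamma (s + a + n) := by
  induction n with
  | zero => simp [mellinPoly, beta, mul_div_assoc, mul_assoc]
  | succ n ih =>
    have h1 : Real.Gamma (s + a + n) ≠ 0 := (Real.Gamma_pos_of_pos (by positivity)).ne'
    have h2 : s + a + n ≠ 0 := by positivity
    have h3 : Real.Gamma (s + a + (n + 1 : ℕ)) = (s + a + n) * Real.Gamma (s + a + n) := by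
      rw [← Real.Gamma_add_one h2]; push_cast; ring_nf
    have h4 : s + ((n + 1 : ℕ) : ℝ) + a = s + a + (n + 1 : ℕ) := by ring
    rw [sum_range_succ, ih, beta, h4, Gamma_add_nat hs, h3, mellinPoly, eval_add, eval_mul,
      eval_mul, eval_C, eval_ascPochhammer_eq_prod]
    simp only [eval_add, eval_X, eval_C]
    field_simp
    ring

lemma natDegree_mellinPoly_le (n : ℕ) : (mellinPoly a v n).natDegree ≤ n := by
  induction n with
  | zero => simp [mellinPoly]
  | succ n ih =>
    refine natDegree_add_le_of_degree_le ?_ ?_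
    · exact natDegree_mul_le_of_le ih (natDegree_X_add_C _).le
    · exact (natDegree_C_mul_le _ _).trans (ascPochhammer_natDegree _ _).le

lemma coeff_mellinPoly (n : ℕ) : (mellinPoly a v n).coeff n = ∑ k ∈ range (n + 1), v k := by
  induction n with
  | zero => simp [mellinPoly]
  | succ n ih =>
    have h1 : (ascPochhammer ℝ (n + 1)).coeff (n + 1) = 1 := by
      have := (monic_ascPochhammer ℝ (n + 1)).coeff_natDegree
      rwa [ascPochhammer_natDegree] at this
    rw [mellinPoly, coeff_add, coeff_C_mul, h1, mul_add, coeff_add, coeff_mul_X, coeff_mul_C,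
      coeff_eq_zero_of_natDegree_lt (Nat.lt_succ_of_le (natDegree_mellinPoly_le v n)), ih,
      sum_range_succ _ (n + 1)]
    ring

/-- At `-(n + a)` the recursive part vanishes and only the top coefficient `v (n + 1)` survives.
This yields both injectivity of the transform and the sign of `B_n(1)`. -/
lemma eval_mellinPoly_succ (n : ℕ) :
    (mellinPoly a v (n + 1)).eval (-(n + a))
      = (-1) ^ (n + 1) * (v (n + 1) * ∏ j ∈ range (n + 1), (a + (n - j : ℝ))) := by
  rw [mellinPoly, eval_add, eval_mul, eval_mul, eval_C, eval_ascPochhammer_eq_prod]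
  have : ∏ j ∈ range (n + 1), (-((n : ℝ) + a) + j)
      = (-1) ^ (n + 1) * ∏ j ∈ range (n + 1), (a + (n - j : ℝ)) := by
    rw [← card_range (n + 1), ← prod_const, card_range, ← prod_mul_distrib]
    exact prod_congr rfl fun j _ => by ring
  rw [this]
  simp only [eval_add, eval_X, eval_C]
  ring

lemma prod_add_sub_pos (ha : 0 < a) (n : ℕ) : 0 < ∏ j ∈ range (n + 1), (a + (n - j : ℝ)) := by
  refine prod_pos fun j hj => ?_
  have : (j : ℝ) ≤ n := by exact_mod_cast Nat.le_of_lt_succ (mem_range.mp hj)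
  linarith

lemma eq_zero_of_mellinPoly_eq_zero (ha : 0 < a) {n : ℕ} (h : mellinPoly a v n = 0) :
    ∀ k ≤ n, v k = 0 := by
  induction n with
  | zero =>
    intro k hk
    rw [Nat.le_zero.mp hk]
    simpa [mellinPoly] using h
  | succ n ih =>
    have h1 := eval_mellinPoly_succ (a := a) v n
    rw [h, eval_zero, eq_comm, mul_eq_zero, mul_eq_zero] at h1
    have h2 : v (n + 1) = 0 := by
      rcases h1 with h1 | h1 | h1
      · exact absurd h1 (by simp)
      · exact h1
      · exact absurd h1 (prod_add_sub_pos ha n).ne'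
    rw [mellinPoly, h2, C_0, zero_mul, add_zero, mul_eq_zero] at h
    have h3 := ih (h.resolve_right (X_add_C_ne_zero _))
    intro k hk
    rcases hk.eq_or_lt with rfl | hk
    · exact h2
    · exact h3 k (Nat.le_of_lt_succ hk)

end

lemma exists_eq_C_mul_prod {c : ℕ → ℝ} (hc : Function.Injective c) {n : ℕ} {p : ℝ[X]}
    (hp : p.natDegree ≤ n) (h0 : ∀ l < n, p.eval (c l) = 0) :
    p = C (p.coeff n) * ∏ l ∈ range n, (X - C (c l)) := by
  have hdvd : ∏ l ∈ range n, (X - C (c l)) ∣ p :=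
    Finset.prod_dvd_of_coprime (fun i _ j _ hij => pairwise_coprime_X_sub_C hc hij)
      fun l hl => dvd_iff_isRoot.mpr (h0 l (mem_range.mp hl))
  have hm : (∏ l ∈ range n, (X - C (c l))).Monic := monic_prod_of_monic _ _ fun l _ => monic_X_sub_C _
  have hdeg : (∏ l ∈ range n, (X - C (c l))).natDegree = n := by
    rw [natDegree_prod_of_monic _ _ fun l _ => monic_X_sub_C _]
    simp
  obtain ⟨q, rfl⟩ := hdvd
  by_cases hq : q = 0
  · simp [hq]
  rw [hm.natDegree_mul' hq, hdeg] at hp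
  obtain ⟨r, rfl⟩ := natDegree_eq_zero.mp (show q.natDegree = 0 by omega)
  have hcoeff : (∏ l ∈ range n, (X - C (c l))).coeff n = 1 := by
    have := hm.coeff_natDegree
    rwa [hdeg] at this
  rw [coeff_mul_C, hcoeff, one_mul, mul_comm]

/-! ### Moment matrices of beta type -/

/-- The moments `∫ x ^ (c l + k - 1) (1 - x) ^ (a - 1) dx`. -/
def betaMoment (c : ℕ → ℝ) (a : ℝ) (k l : ℕ) : ℝ := beta (c l + k) a

/-- Up to normalization, `∫ B_n(x) x ^ (s - 1) (1 - x) ^ (a - 1) dx`. -/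
def mellinII (c : ℕ → ℝ) (a : ℝ) (n : ℕ) (s : ℝ) : ℝ :=
  Real.Gamma s / Real.Gamma (s + a + n) * ∏ l ∈ range n, (s - c l)

/-- `B_n(1)`. -/
def typeIIOne (c : ℕ → ℝ) (a : ℝ) (n : ℕ) : ℝ :=
  lowerApply (gaussS (betaMoment c a)) n fun _ => 1

/-- `Q_n(1)`. -/
def typeIOne (c : ℕ → ℝ) (a : ℝ) (n : ℕ) : ℝ :=
  dualApply (betaMoment c a) n fun _ => 1

section
variable {c : ℕ → ℝ} {a : ℝ}

lemma mellinII_of_lt {n l : ℕ} (h : l < n) : mellinII c a n (c l) = 0 := by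
  rw [mellinII, prod_eq_zero (mem_range.mpr h) (sub_self _), mul_zero]

variable (ha : 0 < a) (hpos : ∀ l, 0 < c l) (hinj : Function.Injective c)
include ha hpos hinj

lemma mellinII_self_ne_zero (n : ℕ) : mellinII c a n (c n) ≠ 0 := by
  have := hpos n
  refine mul_ne_zero (div_ne_zero ?_ ?_) (prod_ne_zero_iff.mpr fun l hl => ?_)
  · exact (Real.Gamma_pos_of_pos this).ne'
  · exact (Real.Gamma_pos_of_pos (by positivity)).ne'
  · exact sub_ne_zero.mpr (hinj.ne (mem_range.mp hl).ne')

/-- A left null vector would give a polynomial of degree at most `n` vanishing at the `n + 1`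
distinct points `c l`; it is zero, hence so is the vector. -/
lemma det_betaMoment_ne_zero (n : ℕ) : (leading (betaMoment c a) n).det ≠ 0 := by
  intro h
  obtain ⟨v, hv, h0⟩ := Matrix.exists_vecMul_eq_zero_iff.mpr h
  cases n with
  | zero => exact hv (Subsingleton.elim _ _)
  | succ n =>
    set w : ℕ → ℝ := fun k => if hk : k < n + 1 then v ⟨k, hk⟩ else 0 with hw
    have hsum : ∀ l : Fin (n + 1), ∑ k ∈ range (n + 1), w k * beta (c l + k) a = 0 := fun l => by
      rw [Finset.sum_range, ← show Matrix.vecMul v (leading (betaMoment c a) (n + 1)) l = 0 by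
        rw [h0]; rfl]
      refine sum_congr rfl fun k _ => ?_
      rw [hw]
      beta_reduce
      rw [dif_pos k.2]
      rfl
    have hP : mellinPoly a w n = 0 := by
      refine eq_zero_of_natDegree_lt_card_of_eval_eq_zero _
        (f := fun l : Fin (n + 1) => c l) (fun i j hij => Fin.ext (hinj hij)) (fun l => ?_) ?_
      · have h1 := hsum l
        have h2 := hpos l
        rw [sum_mul_beta w ha h2, div_eq_zero_iff, mul_eq_zero, mul_eq_zero] at h1
        have e1 := (Real.Gamma_pos_of_pos h2).ne'
        have e2 := (Real.Gamma_pos_of_pos ha).ne'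
        have e3 : Real.Gamma (c l + a + n) ≠ 0 := (Real.Gamma_pos_of_pos (by positivity)).ne'
        tauto
      · rw [Fintype.card_fin]
        exact Nat.lt_succ_of_le (natDegree_mellinPoly_le w n)
    refine hv (funext fun k => ?_)
    have h1 := eq_zero_of_mellinPoly_eq_zero w ha hP k (Nat.le_of_lt_succ k.2)
    rw [hw] at h1
    beta_reduce at h1
    rwa [dif_pos k.2] at h1

/-- Orthogonality of `B_n` to the first `n` weights gives the roots `c l`, which exhaust the degree;
the leading coefficient is the coefficient sum of `B_n`, that is `B_n(1)`. -/
lemma mellinPoly_gaussS (n : ℕ) : mellinPoly a (gaussS (betaMoment c a) n) n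
    = C (typeIIOne c a n) * ∏ l ∈ range n, (X - C (c l)) := by
  have h1 : typeIIOne c a n = (mellinPoly a (gaussS (betaMoment c a) n) n).coeff n := by
    rw [coeff_mellinPoly]
    simp [typeIIOne, lowerApply]
  rw [h1]
  refine exists_eq_C_mul_prod hinj (natDegree_mellinPoly_le _ n) fun l hl => ?_
  have h2 := hpos l
  have h3 := gaussS_orthogonal (betaMoment c a) (det_betaMoment_ne_zero ha hpos hinj n) hl
  simp only [betaMoment] at h3
  rw [sum_mul_beta _ ha h2, div_eq_zero_iff, mul_eq_zero, mul_eq_zero] at h3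
  have e1 := (Real.Gamma_pos_of_pos h2).ne'
  have e2 := (Real.Gamma_pos_of_pos ha).ne'
  have e3 : Real.Gamma (c l + a + n) ≠ 0 := (Real.Gamma_pos_of_pos (by positivity)).ne'
  exact (h3.resolve_right e3).resolve_right e2 |>.resolve_right e1

/-- Since `B_n` is monic, evaluating the factorized transform where only its top coefficient
survives equates `B_n(1)` times a positive product with a positive product, the signs `(-1) ^ (n +
1)` cancelling. -/
lemma typeIIOne_pos (n : ℕ) : 0 < typeIIOne c a n := by
  cases n with
  | zero => simp [typeIIOne, lowerApply, gaussS_self]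
  | succ n =>
    have h := eval_mellinPoly_succ (a := a) (gaussS (betaMoment c a) (n + 1)) n
    rw [mellinPoly_gaussS ha hpos hinj, gaussS_self, one_mul, eval_mul, eval_C, eval_prod] at h
    have h1 : ∏ l ∈ range (n + 1), eval (-((n : ℝ) + a)) (X - C (c l))
        = (-1) ^ (n + 1) * ∏ l ∈ range (n + 1), (n + a + c l) := by
      rw [← card_range (n + 1), ← prod_const, card_range, ← prod_mul_distrib]
      refine prod_congr rfl fun l _ => ?_
      simp only [eval_sub, eval_X, eval_C]
      ring
    rw [h1, mul_left_comm] at h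
    have h2 := mul_left_cancel₀ (pow_ne_zero _ (by norm_num)) h
    have h3 : 0 < ∏ l ∈ range (n + 1), ((n : ℝ) + a + c l) := prod_pos fun l _ => by
      have := hpos l
      positivity
    refine pos_of_mul_pos_left ?_ h3.le
    rw [h2]
    exact prod_add_sub_pos ha n

lemma lowerApply_gaussS_beta (n : ℕ) {s : ℝ} (hs : 0 < s) :
    lowerApply (gaussS (betaMoment c a)) n (fun k => beta (s + k) a)
      = typeIIOne c a n * Real.Gamma a * mellinII c a n s := by
  rw [lowerApply, sum_mul_beta _ ha hs, mellinPoly_gaussS ha hpos hinj, eval_mul, eval_C,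
    eval_prod, mellinII]
  simp only [eval_sub, eval_X, eval_C]
  ring

lemma gaussD_betaMoment_ne_zero (n : ℕ) : gaussD (betaMoment c a) n ≠ 0 := by
  have h : gaussD (betaMoment c a) n
      = lowerApply (gaussS (betaMoment c a)) n fun k => beta (c n + k) a := rfl
  rw [h, lowerApply_gaussS_beta ha hpos hinj n (hpos n)]
  exact mul_ne_zero (mul_ne_zero (typeIIOne_pos ha hpos hinj n).ne'
    (Real.Gamma_pos_of_pos ha).ne') (mellinII_self_ne_zero ha hpos hinj n)

/-- This is the recurrence for `x B_n` under the Mellin transform, where the factor `x` shifts `s`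
by one. -/
lemma sum_hessenberg_mellinII (n : ℕ) {s : ℝ} (hs : 0 < s) :
    ∑ m ∈ range (n + 2), (typeIIOne c a n)⁻¹ * hessenberg (betaMoment c a) n m
      * typeIIOne c a m * mellinII c a m s = mellinII c a n (s + 1) := by
  have h := sum_hessenberg_mul_lowerApply (betaMoment c a) n fun k => beta (s + k) a
  have h1 : ∀ k : ℕ, s + ((k + 1 : ℕ) : ℝ) = s + 1 + k := fun k => by push_cast; ring
  simp only [h1, lowerApply_gaussS_beta ha hpos hinj _ hs,
    lowerApply_gaussS_beta ha hpos hinj _ (show 0 < s + 1 by linarith)] at h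
  have e1 := (typeIIOne_pos ha hpos hinj n).ne'
  have e2 := (Real.Gamma_pos_of_pos ha).ne'
  refine mul_left_cancel₀ (mul_ne_zero e1 e2) ?_
  rw [← h, mul_sum]
  refine sum_congr rfl fun m _ => ?_
  field_simp

/-- Expansions in the functions `mellinII` are unique. -/
lemma eq_of_sum_mul_mellinII_eq {N : ℕ} {p q : ℕ → ℝ}
    (h : ∀ s, 0 < s → ∑ m ∈ range N, p m * mellinII c a m s
      = ∑ m ∈ range N, q m * mellinII c a m s) : ∀ m < N, p m = q m := by
  intro m
  induction m using Nat.strong_induction_on with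
  | _ m ih =>
    intro hm
    -- At `c m` the terms beyond `m` vanish and those before `m` agree by induction, so the system
    -- is triangular.
    have h1 := h (c m) (hpos m)
    rw [← sub_eq_zero, ← sum_sub_distrib, sum_eq_single_of_mem m (mem_range.mpr hm), ← sub_mul,
      mul_eq_zero] at h1
    · exact sub_eq_zero.mp (h1.resolve_right (mellinII_self_ne_zero ha hpos hinj m))
    · intro k hk hkm
      rcases hkm.lt_or_gt with hlt | hgt
      · rw [ih k hlt (mem_range.mp hk), sub_self]
      · rw [mellinII_of_lt hgt, mul_zero, mul_zero, sub_self]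

end

/-! ### Nonnegativity of the connection coefficients -/

lemma sub_div_add_le_sub_div_add {r M t u : ℝ} (hM : 0 ≤ M + r) (ht : 0 < t + M) (htu : t ≤ u) :
    (t - r) / (t + M) ≤ (u - r) / (u + M) := by
  rw [div_le_div_iff₀ ht (by linarith)]
  nlinarith [mul_nonneg hM (sub_nonneg.mpr htu)]

lemma prod_sub_div_add_mono {r₁ r₂ r₃ M₁ M₂ M₃ t u : ℝ} (h₁ : 0 ≤ M₁ + r₁) (h₂ : 0 ≤ M₂ + r₂)
    (h₃ : 0 ≤ M₃ + r₃) (k₁ : 0 < t + M₁) (k₂ : 0 < t + M₂) (k₃ : 0 < t + M₃)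
    (l₁ : 0 ≤ t - r₁) (l₂ : 0 ≤ t - r₂) (l₃ : 0 ≤ t - r₃) (htu : t ≤ u) :
    (t - r₁) / (t + M₁) * ((t - r₂) / (t + M₂)) * ((t - r₃) / (t + M₃))
      ≤ (u - r₁) / (u + M₁) * ((u - r₂) / (u + M₂)) * ((u - r₃) / (u + M₃)) := by
  have e₁ := sub_div_add_le_sub_div_add h₁ k₁ htu
  have e₂ := sub_div_add_le_sub_div_add h₂ k₂ htu
  have e₃ := sub_div_add_le_sub_div_add h₃ k₃ htu
  have f₁ := div_nonneg l₁ k₁.le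
  have f₂ := div_nonneg l₂ k₂.le
  have f₃ := div_nonneg l₃ k₃.le
  exact mul_le_mul (mul_le_mul e₁ e₂ f₂ (f₁.trans e₁)) e₃ f₃
    (mul_nonneg (f₁.trans e₁) (f₂.trans e₂))

/-- The expansion of a cubic polynomial with respect to the products of initial factors of
`(s - A)(s - B)(s - A - 1)` and `(s + N)(s + N - 1)(s + N - 2)` has nonnegative coefficients. -/
lemma exists_nonneg_cubic_expansion {A B N x y : ℝ} (hA : 0 < A) (hB : 0 < B) (hAB : A ≠ B)
    (hAx : x ≤ A) (hAy : y ≤ A) (hBx : x ≤ B) (hBy : y ≤ B) (hN : 2 < N)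
    (hNx : 0 < N - 1 + x) (hNy : 0 < N - 1 + y) :
    ∃ p₀ p₁ p₂ p₃ : ℝ, 0 ≤ p₀ ∧ 0 ≤ p₁ ∧ 0 ≤ p₂ ∧ 0 ≤ p₃ ∧ ∀ s : ℝ, s * (s - x) * (s - y)
      = p₀ * ((s + N) * (s + N - 1) * (s + N - 2)) + p₁ * ((s + N) * (s + N - 1) * (s - A))
        + p₂ * ((s + N) * (s - A) * (s - B)) + p₃ * ((s - A) * (s - B) * (s - A - 1)) := by
  -- The coefficients come from evaluating the identity at the nodes `A`, `B`, `-N`, `1 - N`, where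
  -- most basis products vanish. `φ` is the cubic divided by the first basis product; `ψ` is the
  -- ratio of the cubic to the last one at `-t`. Thus `p₀` and `p₃` are values, and `p₁` and `p₂`
  -- are positive multiples of difference quotients. The four nodes also suffice to verify the
  -- identity, which has degree at most three.
  set φ : ℝ → ℝ := fun t =>
    (t - 0) / (t + (N - 2)) * ((t - x) / (t + (N - 1))) * ((t - y) / (t + N)) with hφ
  set ψ : ℝ → ℝ := fun t =>
    (t - 0) / (t + A) * ((t - -x) / (t + B)) * ((t - -y) / (t + (A + 1))) with hψ
  have hφ_mono : ∀ {t u}, 0 < t → x ≤ t → y ≤ t → t ≤ u → φ t ≤ φ u := fun h0 hx hy h =>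
    prod_sub_div_add_mono (by linarith) (by linarith) (by linarith) (by linarith) (by linarith)
      (by linarith) (by linarith) (by linarith) (by linarith) h
  have hψ_mono : ψ (N - 1) ≤ ψ N :=
    prod_sub_div_add_mono (by linarith) (by linarith) (by linarith) (by linarith) (by linarith)
      (by linarith) (by linarith) (by linarith) (by linarith) (by linarith)
  have hφA : 0 ≤ φ A := mul_nonneg (mul_nonneg (div_nonneg (by linarith) (by linarith))
    (div_nonneg (by linarith) (by linarith))) (div_nonneg (by linarith) (by linarith))
  have hψN : 0 ≤ ψ N := mul_nonneg (mul_nonneg (div_nonneg (by linarith) (by linarith))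
    (div_nonneg (by linarith) (by linarith))) (div_nonneg (by linarith) (by linarith))
  have hslope : 0 ≤ (φ B - φ A) / (B - A) := by
    rcases hAB.lt_or_gt with h | h
    · exact div_nonneg (sub_nonneg.mpr (hφ_mono hA hAx hAy h.le)) (by linarith)
    · exact div_nonneg_of_nonpos (sub_nonpos.mpr (hφ_mono hB hBx hBy h.le)) (by linarith)
  refine ⟨φ A, (φ B - φ A) / (B - A) * (B + N - 2), (N + A) * (ψ N - ψ (N - 1)), ψ N, hφA,
    mul_nonneg hslope (by linarith), mul_nonneg (by linarith) (sub_nonneg.mpr hψ_mono), hψN, ?_⟩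
  generalize hp₁ : (φ B - φ A) / (B - A) * (B + N - 2) = p₁
  generalize hp₂ : (N + A) * (ψ N - ψ (N - 1)) = p₂
  set q : ℝ[X] := X * (X - C x) * (X - C y)
    - (C (φ A) * ((X + C N) * (X + C N - 1) * (X + C N - C 2))
      + C p₁ * ((X + C N) * (X + C N - 1) * (X - C A)) + C p₂ * ((X + C N) * (X - C A) * (X - C B))
      + C (ψ N) * ((X - C A) * (X - C B) * (X - C A - 1))) with hq
  have hqe : ∀ s, q.eval s = s * (s - x) * (s - y)
      - (φ A * ((s + N) * (s + N - 1) * (s + N - 2)) + p₁ * ((s + N) * (s + N - 1) * (s - A))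
        + p₂ * ((s + N) * (s - A) * (s - B)) + ψ N * ((s - A) * (s - B) * (s - A - 1))) :=
    fun s => by simp [hq]
  suffices h : q = 0 by
    intro s
    have := hqe s
    rw [h, eval_zero] at this
    linarith
  have a0 : A + N ≠ 0 := by linarith
  have a1 : A + (N - 1) ≠ 0 := by linarith
  have a2 : A + (N - 2) ≠ 0 := by linarith
  have b0 : B + N ≠ 0 := by linarith
  have b1 : B + (N - 1) ≠ 0 := by linarith
  have b2 : B + (N - 2) ≠ 0 := by linarith
  have fA : A * (A - x) * (A - y) = φ A * ((A + N) * (A + N - 1) * (A + N - 2)) := by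
    simp only [hφ]; field_simp; ring
  have fB : B * (B - x) * (B - y) = φ B * ((B + N) * (B + N - 1) * (B + N - 2)) := by
    simp only [hφ]; field_simp; ring
  have fN : N * (N + x) * (N + y) = ψ N * ((N + A) * (N + B) * (N + A + 1)) := by
    have : N + A ≠ 0 := by linarith
    have : N + B ≠ 0 := by linarith
    have : N + (A + 1) ≠ 0 := by linarith
    simp only [hψ]; field_simp; ring
  have fN1 : (N - 1) * (N - 1 + x) * (N - 1 + y)
      = ψ (N - 1) * ((N - 1 + A) * (N - 1 + B) * (N + A)) := by
    have : N - 1 + A ≠ 0 := by linarith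
    have : N - 1 + B ≠ 0 := by linarith
    have : N - 1 + (A + 1) ≠ 0 := by linarith
    simp only [hψ]; field_simp; ring
  have fp₁ : p₁ * (B - A) = (φ B - φ A) * (B + N - 2) := by
    have : B - A ≠ 0 := sub_ne_zero.mpr hAB.symm
    rw [← hp₁]; field_simp
  have hnodes : Function.Injective ![A, B, -N, 1 - N] := by
    intro i j hij
    fin_cases i <;> fin_cases j <;> simp at hij ⊢ <;>
      first
        | exact absurd hij hAB
        | exact absurd hij.symm hAB
        | linarith
  refine eq_zero_of_natDegree_lt_card_of_eval_eq_zero q hnodes (fun i => ?_) ?_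
  · rw [hqe]
    fin_cases i
    · simp only [Fin.zero_eta, Matrix.cons_val_zero]
      linear_combination fA
    · simp only [Fin.mk_one, Matrix.cons_val_one, Matrix.cons_val_zero]
      linear_combination fB - (B + N) * (B + N - 1) * fp₁
    · simp only [Fin.reduceFinMk, Matrix.cons_val]
      linear_combination -fN
    · simp only [Fin.reduceFinMk, Matrix.cons_val]
      rw [← hp₂]
      linear_combination -fN1
  · rw [Fintype.card_fin]
    refine Nat.lt_succ_of_le ?_
    rw [hq]
    compute_degree

/-- The hypothesis `|c 0 - c 1| < 1` places the roots `c 0 - 1` and `c 1 - 1` of the shifted product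
below every `c l`, as the cubic expansion requires. -/
lemma sub_one_le_of_shift {c : ℕ → ℝ} (hshift : ∀ l, c (l + 2) = c l + 1)
    (h01 : |c 0 - c 1| < 1) (l : ℕ) : c 0 - 1 ≤ c l ∧ c 1 - 1 ≤ c l := by
  have := abs_lt.mp h01
  induction l using Nat.twoStepInduction with
  | zero => constructor <;> linarith
  | one => constructor <;> linarith
  | more l ih _ => rw [hshift]; constructor <;> linarith [ih.1, ih.2]

section
variable {c : ℕ → ℝ} {a : ℝ} (ha : 0 < a) (hpos : ∀ l, 0 < c l)
include ha

lemma Gamma_add_nat_succ {s : ℝ} (hs : 0 < s) (n : ℕ) :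
    Real.Gamma (s + a + (n + 1 : ℕ)) = (s + a + n) * Real.Gamma (s + a + n) := by
  rw [← Real.Gamma_add_one (by positivity)]
  push_cast
  ring_nf

include hpos

lemma exists_nonneg_expansion_zero : ∃ p : ℕ → ℝ, (∀ m, 0 ≤ p m) ∧ ∀ s, 0 < s →
    mellinII c a 0 (s + 1) = ∑ m ∈ range 2, p m * mellinII c a m s := by
  have h0 := hpos 0
  -- The weights solve `s = p₀ (s + a) + p₁ (s - c 0)`: put `s = c 0` and `s = -a`.
  refine ⟨fun m => if m = 0 then c 0 / (a + c 0) else a / (a + c 0), fun m => ?_, fun s hs => ?_⟩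
  · dsimp only
    split_ifs <;> positivity
  · have h1 : s + a ≠ 0 := by positivity
    have h2 : Real.Gamma (s + a) ≠ 0 := (Real.Gamma_pos_of_pos (by positivity)).ne'
    have h3 := Gamma_add_nat_succ ha hs 0
    have h4 : s + 1 + a + ((0 : ℕ) : ℝ) = s + a + (0 + 1 : ℕ) := by push_cast; ring
    simp only [sum_range_succ, mellinII, prod_range_succ, range_zero, sum_empty, prod_empty]
    rw [h4, h3, Real.Gamma_add_one hs.ne']
    simp only [CharP.cast_eq_zero, add_zero, zero_add, if_true, one_ne_zero, if_false]
    have h5 : a + c 0 ≠ 0 := by positivity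
    field_simp
    ring

lemma exists_nonneg_expansion_one : ∃ p : ℕ → ℝ, (∀ m, 0 ≤ p m) ∧ ∀ s, 0 < s →
    mellinII c a 1 (s + 1) = ∑ m ∈ range 3, p m * mellinII c a m s := by
  have h0 := hpos 0
  have h1 := hpos 1
  -- The weights solve `s (s + 1 - c 0) = p₀ (s + a) (s + a + 1) + p₁ (s - c 0) (s + a + 1) + p₂ (s
  -- - c 0) (s - c 1)`: `s = c 0` gives `p₀`, `s = -a - 1` gives `p₂`, and leading coefficients give
  -- `p₁`.
  refine ⟨fun m => if m = 0 then c 0 / ((c 0 + 1 + a) * (c 0 + a))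
    else if m = 1 then ((a + c 0) ^ 2 * c 1 + a + a * (a + c 1))
      / ((1 + a + c 0) * (1 + a + c 1) * (a + c 0))
    else (1 + a) * (a + c 0) / ((1 + a + c 0) * (1 + a + c 1)), fun m => ?_, fun s hs => ?_⟩
  · dsimp only
    split_ifs <;> positivity
  · have h2 : s + a ≠ 0 := by positivity
    have h2' : s + a + 1 ≠ 0 := by positivity
    have h3 : Real.Gamma (s + a) ≠ 0 := (Real.Gamma_pos_of_pos (by positivity)).ne'
    have h4 := Gamma_add_nat_succ ha hs 0
    have h5 := Gamma_add_nat_succ ha hs 1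
    have h6 : s + 1 + a + ((1 : ℕ) : ℝ) = s + a + (1 + 1 : ℕ) := by push_cast; ring
    simp only [zero_add, CharP.cast_eq_zero, add_zero] at h4
    simp only [sum_range_succ, mellinII, prod_range_succ, range_zero, sum_empty, prod_empty]
    rw [h6, h5, h4, Real.Gamma_add_one hs.ne']
    simp only [Nat.cast_one, CharP.cast_eq_zero, add_zero, zero_add, if_true, one_ne_zero,
      if_false, OfNat.ofNat_ne_zero, OfNat.ofNat_ne_one]
    have e1 : a + c 0 ≠ 0 := by positivity
    have e2 : c 0 + 1 + a ≠ 0 := by positivity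
    have e3 : 1 + a + c 0 ≠ 0 := by positivity
    have e4 : 1 + a + c 1 ≠ 0 := by positivity
    rw [show c 0 + 1 + a = 1 + a + c 0 by ring, add_comm (c 0) a]
    field_simp
    ring

variable (hshift : ∀ l, c (l + 2) = c l + 1) (hinj : Function.Injective c)
  (h01 : |c 0 - c 1| < 1)
include hshift hinj h01

/-- Both sides share `Γ(s) / Γ(s + a + k + 3) * ∏ l < k, (s - c l)`. Cancelling it leaves the cubic
identity with `A = c k`, `B = c (k + 1)`, `N = k + 2 + a`; the factor `s - A - 1` is `s - c (k +
2)`. -/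
lemma exists_nonneg_expansion_add_two (k : ℕ) : ∃ p : ℕ → ℝ, (∀ m, 0 ≤ p m) ∧ ∀ s, 0 < s →
    mellinII c a (k + 2) (s + 1) = ∑ m ∈ range (k + 4), p m * mellinII c a m s := by
  have h0 := hpos 0
  have h1 := hpos 1
  have hk : (0 : ℝ) ≤ k := k.cast_nonneg
  obtain ⟨hA0, hA1⟩ := sub_one_le_of_shift hshift h01 k
  obtain ⟨hB0, hB1⟩ := sub_one_le_of_shift hshift h01 (k + 1)
  obtain ⟨p₀, p₁, p₂, p₃, hp₀, hp₁, hp₂, hp₃, hp⟩ := exists_nonneg_cubic_expansion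
    (N := k + 2 + a) (hpos k) (hpos (k + 1)) (hinj.ne k.lt_succ_self.ne) hA0 hA1 hB0 hB1
    (by linarith) (by linarith) (by linarith)
  refine ⟨fun m => if m = k then p₀ else if m = k + 1 then p₁ else if m = k + 2 then p₂
    else if m = k + 3 then p₃ else 0, fun m => ?_, fun s hs => ?_⟩
  · dsimp only
    split_ifs <;> first | assumption | exact le_rfl
  have hz : ∑ m ∈ range k, (if m = k then p₀ else if m = k + 1 then p₁ else if m = k + 2 then p₂
      else if m = k + 3 then p₃ else 0) * mellinII c a m s = 0 := by
    refine sum_eq_zero fun m hm => ?_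
    have := mem_range.mp hm
    rw [if_neg (by omega), if_neg (by omega), if_neg (by omega), if_neg (by omega), zero_mul]
  rw [sum_range_succ, sum_range_succ, sum_range_succ, sum_range_succ, hz]
  simp only [if_true, Nat.add_eq_left, add_right_inj, OfNat.ofNat_ne_one, OfNat.ofNat_ne_zero,
    one_ne_zero, if_false, Nat.reduceEqDiff, zero_add]
  have hprod : ∏ l ∈ range (k + 2), (s + 1 - c l)
      = (s - (c 0 - 1)) * (s - (c 1 - 1)) * ∏ l ∈ range k, (s - c l) := by
    rw [prod_range_succ', prod_range_succ']
    simp only [hshift, zero_add]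
    have : ∀ l, s + 1 - (c l + 1) = s - c l := fun l => by ring
    simp only [this]
    ring
  have hG : Real.Gamma (s + a + k) ≠ 0 := (Real.Gamma_pos_of_pos (by positivity)).ne'
  have hs0 : s + a + k ≠ 0 := by positivity
  have hs1 : s + a + ((k + 1 : ℕ) : ℝ) ≠ 0 := by positivity
  have hs2 : s + a + ((k + 2 : ℕ) : ℝ) ≠ 0 := by positivity
  have hΓ : s + 1 + a + ((k + 2 : ℕ) : ℝ) = s + a + (k + 3 : ℕ) := by push_cast; ring
  have g1 := Gamma_add_nat_succ ha hs k
  have g2 := Gamma_add_nat_succ ha hs (k + 1)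
  have g3 := Gamma_add_nat_succ ha hs (k + 2)
  simp only [mellinII]
  rw [hprod, hΓ, g3, g2, g1, Real.Gamma_add_one hs.ne', prod_range_succ _ (k + 2),
    prod_range_succ _ (k + 1), prod_range_succ _ k, hshift]
  push_cast at hs1 hs2 ⊢
  field_simp
  linear_combination (∏ l ∈ range k, (s - c l)) * hp s

lemma exists_nonneg_expansion (n : ℕ) : ∃ p : ℕ → ℝ, (∀ m, 0 ≤ p m) ∧ ∀ s, 0 < s →
    mellinII c a n (s + 1) = ∑ m ∈ range (n + 2), p m * mellinII c a m s :=
  match n with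
  | 0 => exists_nonneg_expansion_zero ha hpos
  | 1 => exists_nonneg_expansion_one ha hpos
  | k + 2 => exists_nonneg_expansion_add_two ha hpos hshift hinj h01 k

lemma hessenberg_nonneg (n m : ℕ) : 0 ≤ hessenberg (betaMoment c a) n m := by
  rcases lt_or_ge m (n + 2) with hm | hm
  · obtain ⟨p, hp, h⟩ := exists_nonneg_expansion ha hpos hshift hinj h01 n
    have h1 := eq_of_sum_mul_mellinII_eq ha hpos hinj (fun s hs =>
      (sum_hessenberg_mellinII ha hpos hinj n hs).trans (h s hs)) m hm
    have h2 := typeIIOne_pos ha hpos hinj n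
    have h3 := typeIIOne_pos ha hpos hinj m
    have h4 := hp m
    rw [← h1] at h4
    exact nonneg_of_mul_nonneg_right (nonneg_of_mul_nonneg_left h4 h3) (inv_pos.mpr h2)
  · rw [hessenberg_of_lt _ (by omega)]

end

/-! ### The two dual chains -/

lemma betaMoment_shift {c : ℕ → ℝ} {a : ℝ} (hshift : ∀ l, c (l + 2) = c l + 1) (k l : ℕ) :
    betaMoment c a (k + 1) l = betaMoment c a k (l + 2) := by
  simp only [betaMoment, hshift]
  push_cast
  ring_nf

/-- The iterated pairings `∫ xᵏ B_i Q_j dμ` are asymptotic to `B_i(1) Q_j(1) Γ(a) k ^ (-a)`. -/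
lemma tendsto_rpow_mul_pairing {c : ℕ → ℝ} {a : ℝ} (ha : 0 < a) (hpos : ∀ l, 0 < c l)
    (i j : ℕ) : Tendsto (fun k : ℕ => (k : ℝ) ^ a * pairing (betaMoment c a) k i j) atTop
      (𝓝 (typeIIOne c a i * typeIOne c a j * Real.Gamma a)) := by
  have h1 : ∀ k : ℕ, (k : ℝ) ^ a * pairing (betaMoment c a) k i j
      = ∑ m ∈ range (i + 1), ∑ l ∈ range (j + 1), gaussS (betaMoment c a) i m
        * ((gaussD (betaMoment c a) j)⁻¹ * gaussT (betaMoment c a) j l)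
        * ((k : ℝ) ^ a * beta (k + (c l + m)) a) := fun k => by
    simp only [pairing, lowerApply, dualApply, betaMoment, mul_sum]
    refine sum_congr rfl fun m _ => sum_congr rfl fun l _ => ?_
    rw [show c l + ((m + k : ℕ) : ℝ) = k + (c l + m) by push_cast; ring]
    ring
  have h2 : typeIIOne c a i * typeIOne c a j * Real.Gamma a
      = ∑ m ∈ range (i + 1), ∑ l ∈ range (j + 1), gaussS (betaMoment c a) i m
        * ((gaussD (betaMoment c a) j)⁻¹ * gaussT (betaMoment c a) j l) * Real.Gamma a := by
    simp only [typeIIOne, typeIOne, lowerApply, dualApply, mul_one, mul_sum, sum_mul]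
    rw [sum_comm]
  simp only [h1]
  rw [h2]
  refine tendsto_finsetSum _ fun m _ => tendsto_finsetSum _ fun l _ => ?_
  have := hpos l
  exact (tendsto_rpow_mul_beta (by positivity) ha).const_mul _

section
variable {c : ℕ → ℝ} {a : ℝ} (ha : 0 < a) (hpos : ∀ l, 0 < c l)
  (hshift : ∀ l, c (l + 2) = c l + 1) (hinj : Function.Injective c) (h01 : |c 0 - c 1| < 1)
include ha hpos hshift hinj h01

lemma pairing_nonneg (k i j : ℕ) : 0 ≤ pairing (betaMoment c a) k i j := by
  induction k generalizing i with
  | zero =>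
    rw [pairing_zero (det_betaMoment_ne_zero ha hpos hinj)
      (gaussD_betaMoment_ne_zero ha hpos hinj)]
    split_ifs <;> norm_num
  | succ k ih =>
    rw [pairing_succ]
    exact sum_nonneg fun m _ => mul_nonneg (hessenberg_nonneg ha hpos hshift hinj h01 i m) (ih m)

/-- The limit of the nonnegative quantities `k ^ a * pairing k 0 n` is `B_0(1) Q_n(1) Γ(a)`, and the
other two factors are positive. -/
lemma typeIOne_nonneg (n : ℕ) : 0 ≤ typeIOne c a n := by
  have h := ge_of_tendsto' (tendsto_rpow_mul_pairing ha hpos 0 n) fun k =>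
    mul_nonneg (Real.rpow_nonneg k.cast_nonneg a)
      (pairing_nonneg ha hpos hshift hinj h01 k 0 n)
  exact nonneg_of_mul_nonneg_right (nonneg_of_mul_nonneg_left h (Real.Gamma_pos_of_pos ha))
    (typeIIOne_pos ha hpos hinj 0)

omit h01 in
lemma sum_hessenberg_mul_typeIOne (n : ℕ) :
    ∑ m ∈ range (n + 3), hessenberg (betaMoment c a) m n * typeIOne c a m = typeIOne c a n :=
  sum_hessenberg_mul_dualApply (det_betaMoment_ne_zero ha hpos hinj)
    (gaussD_betaMoment_ne_zero ha hpos hinj) (betaMoment_shift hshift) n fun _ => 1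

/-- `Q_0(1)` is nonzero, and the superdiagonal ones of `H` propagate positivity: the nonnegative sum
expressing `Q_(n+1)(1)` contains the term `Q_n(1)`. -/
lemma typeIOne_pos (n : ℕ) : 0 < typeIOne c a n := by
  have hnn := typeIOne_nonneg ha hpos hshift hinj h01
  induction n with
  | zero =>
    refine lt_of_le_of_ne (hnn 0) (Ne.symm ?_)
    simp [typeIOne, dualApply, lowerApply, gaussT_self, gaussD_betaMoment_ne_zero ha hpos hinj 0]
  | succ n ih =>
    rw [← sum_hessenberg_mul_typeIOne ha hpos hshift hinj (n + 1)]
    refine lt_of_lt_of_le ?_ (single_le_sum (fun m _ => mul_nonneg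
      (hessenberg_nonneg ha hpos hshift hinj h01 m (n + 1)) (hnn m))
      (mem_range.mpr (show n < n + 1 + 3 by omega)))
    rw [hessenberg_succ, one_mul]
    exact ih

/-- The transition matrix of type II. -/
lemma hatChain (P : ℕ → ℕ → ℝ) (hP : ∀ n m, P n m
      = (typeIIOne c a n)⁻¹ * hessenberg (betaMoment c a) n m * typeIIOne c a m) :
    (∀ i j, 0 ≤ P i j) ∧ (∀ i j, i + 3 ≤ j → P i j = 0)
      ∧ (∀ i, ∑ j ∈ range (i + 3), P i j = 1)
      ∧ ∀ n i, bandPow P n i i = pairing (betaMoment c a) n i i := by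
  have hB := typeIIOne_pos ha hpos hinj
  have hb : ∀ i j, i + 2 ≤ j → P i j = 0 := fun i j hij => by
    rw [hP, hessenberg_of_lt _ (by omega), mul_zero, zero_mul]
  have hsum : ∀ i (f : ℕ → ℝ), ∑ j ∈ range (i + 3), P i j * f j
      = (typeIIOne c a i)⁻¹
        * ∑ j ∈ range (i + 2), hessenberg (betaMoment c a) i j * (typeIIOne c a j * f j) :=
    fun i f => by
      rw [sum_range_succ, hb i _ le_rfl, zero_mul, add_zero, mul_sum]
      exact sum_congr rfl fun j _ => by rw [hP]; ring
  refine ⟨fun i j => ?_, fun i j h => hb i j (by omega), fun i => ?_, fun n i => ?_⟩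
  · rw [hP]
    exact mul_nonneg (mul_nonneg (inv_nonneg.mpr (hB i).le)
      (hessenberg_nonneg ha hpos hshift hinj h01 i j)) (hB j).le
  · have h := hsum i fun _ => 1
    simp only [mul_one] at h
    rw [h]
    have h2 : ∑ m ∈ range (i + 2), hessenberg (betaMoment c a) i m * typeIIOne c a m
        = typeIIOne c a i := sum_hessenberg_mul_lowerApply (betaMoment c a) i fun _ => 1
    rw [h2, inv_mul_cancel₀ (hB i).ne']
  · have key : ∀ j, bandPow P n j i
        = (typeIIOne c a j)⁻¹ * pairing (betaMoment c a) n j i * typeIIOne c a i := by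
      induction n with
      | zero =>
        intro j
        rw [bandPow, pairing_zero (det_betaMoment_ne_zero ha hpos hinj)
          (gaussD_betaMoment_ne_zero ha hpos hinj)]
        split_ifs with h
        · rw [h, mul_one, inv_mul_cancel₀ (hB i).ne']
        · simp
      | succ n ih =>
        intro j
        rw [bandPow, hsum j fun m => bandPow P n m i, pairing_succ, mul_assoc, sum_mul]
        refine congrArg _ (sum_congr rfl fun m _ => ?_)
        have := (hB m).ne'
        rw [ih]
        field_simp
    have := (hB i).ne'
    rw [key]
    field_simp

/-- The transition matrix of type I. -/
lemma checkChain (P : ℕ → ℕ → ℝ) (hP : ∀ n m, P n m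
      = (typeIOne c a n)⁻¹ * hessenberg (betaMoment c a) m n * typeIOne c a m) :
    (∀ i j, 0 ≤ P i j) ∧ (∀ i j, i + 3 ≤ j → P i j = 0)
      ∧ (∀ i, ∑ j ∈ range (i + 3), P i j = 1)
      ∧ ∀ n i, bandPow P n i i = pairing (betaMoment c a) n i i := by
  have hQ := typeIOne_pos ha hpos hshift hinj h01
  have hg := det_betaMoment_ne_zero ha hpos hinj
  have hD := gaussD_betaMoment_ne_zero ha hpos hinj
  have hsum : ∀ i (f : ℕ → ℝ), ∑ j ∈ range (i + 3), P i j * f j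
      = (typeIOne c a i)⁻¹
        * ∑ j ∈ range (i + 3), hessenberg (betaMoment c a) j i * (typeIOne c a j * f j) :=
    fun i f => by
      rw [mul_sum]
      exact sum_congr rfl fun j _ => by rw [hP]; ring
  refine ⟨fun i j => ?_, fun i j h => ?_, fun i => ?_, fun n i => ?_⟩
  · rw [hP]
    exact mul_nonneg (mul_nonneg (inv_nonneg.mpr (hQ i).le)
      (hessenberg_nonneg ha hpos hshift hinj h01 j i)) (hQ j).le
  · rw [hP, hessenberg_of_add_three_le hg hD (betaMoment_shift hshift) h, mul_zero, zero_mul]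
  · have h := hsum i fun _ => 1
    simp only [mul_one] at h
    rw [h, sum_hessenberg_mul_typeIOne ha hpos hshift hinj, inv_mul_cancel₀ (hQ i).ne']
  -- The chain runs on the transpose of `H`, so the pairing has `i` and `j` exchanged and its
  -- recursion runs over the type I index. The conjugating factors cancel at `j = i`.
  · have key : ∀ j, bandPow P n j i
        = (typeIOne c a j)⁻¹ * pairing (betaMoment c a) n i j * typeIOne c a i := by
      induction n with
      | zero =>
        intro j
        rw [bandPow, pairing_zero hg hD]
        by_cases h : j = i
        · rw [if_pos h, if_pos h.symm, h, mul_one, inv_mul_cancel₀ (hQ i).ne']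
        · rw [if_neg h, if_neg (Ne.symm h), mul_zero, zero_mul]
      | succ n ih =>
        intro j
        rw [bandPow, hsum j fun m => bandPow P n m i,
          pairing_succ' hg hD (betaMoment_shift hshift), mul_assoc, sum_mul]
        refine congrArg _ (sum_congr rfl fun m _ => ?_)
        have := (hQ m).ne'
        rw [ih]
        field_simp
    have := (hQ i).ne'
    rw [key]
    field_simp

lemma summable_pairing_iff (i : ℕ) :
    (Summable fun n => pairing (betaMoment c a) n i i) ↔ 1 < a :=
  summable_iff_of_tendsto_rpow_mul
    (mul_pos (mul_pos (typeIIOne_pos ha hpos hinj i) (typeIOne_pos ha hpos hshift hinj h01 i))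
      (Real.Gamma_pos_of_pos ha))
    (tendsto_rpow_mul_pairing ha hpos i i)

lemma recurrent_transient_of_chain {P : ℕ → ℕ → ℝ}
    (hP : (∀ i j, 0 ≤ P i j) ∧ (∀ i j, i + 3 ≤ j → P i j = 0)
      ∧ (∀ i, ∑ j ∈ range (i + 3), P i j = 1)
      ∧ ∀ n i, bandPow P n i i = pairing (betaMoment c a) n i i) :
    (a ≤ 1 → IsRecurrent P) ∧ (1 < a → IsTransient P) := by
  obtain ⟨h0, hb, h1, hpow⟩ := hP
  refine ⟨fun h => isRecurrent_of_not_summable h0 hb h1 fun i => ?_,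
    fun h => isTransient_of_summable h0 hb h1 fun i => ?_⟩
  · simp only [hpow, summable_pairing_iff ha hpos hshift hinj h01]
    exact not_lt.mpr h
  · simp only [hpow, summable_pairing_iff ha hpos hshift hinj h01]
    exact h

end

/-! ### The Jacobi--Piñeiro exponents -/

/-- `x ^ (expo l - 1)` is the `l`-th entry of `ξ`. -/
def expo (α₁ α₂ : ℝ) (l : ℕ) : ℝ :=
  (l / 2 : ℕ) + (if l % 2 = 0 then α₁ else α₂) + 1

section
variable {α₁ α₂ : ℝ}

lemma expo_add_two (l : ℕ) : expo α₁ α₂ (l + 2) = expo α₁ α₂ l + 1 := by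
  simp only [expo, Nat.add_mod_right, Nat.add_div_right l two_pos]
  push_cast
  ring

lemma expo_pos (h₁ : -1 < α₁) (h₂ : -1 < α₂) (l : ℕ) : 0 < expo α₁ α₂ l := by
  have : (0 : ℝ) ≤ (l / 2 : ℕ) := Nat.cast_nonneg _
  rw [expo]
  split_ifs <;> linarith

lemma expo_injective (hne : ∀ k : ℤ, α₁ - α₂ ≠ k) : Function.Injective (expo α₁ α₂) := by
  intro i j hij
  simp only [expo] at hij
  have h1 := hne ((i / 2 : ℕ) - (j / 2 : ℕ))
  have h2 := hne ((j / 2 : ℕ) - (i / 2 : ℕ))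
  rw [Int.cast_sub, Int.cast_natCast, Int.cast_natCast] at h1 h2
  split_ifs at hij with hi hj hj
  · have : i / 2 = j / 2 := by exact_mod_cast (show ((i / 2 : ℕ) : ℝ) = (j / 2 : ℕ) by linarith)
    omega
  · exact absurd (by linarith) h2
  · exact absurd (by linarith) h1
  · have : i / 2 = j / 2 := by exact_mod_cast (show ((i / 2 : ℕ) : ℝ) = (j / 2 : ℕ) by linarith)
    omega

lemma xi_eq_rpow {x : ℝ} (hx : 0 < x) (l : ℕ) : xi α₁ α₂ l x = x ^ (expo α₁ α₂ l - 1) := by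
  rw [xi, expo, add_sub_cancel_right, Real.rpow_add hx, Real.rpow_natCast]
  split_ifs <;> rfl

lemma xi_one (l : ℕ) : xi α₁ α₂ l 1 = 1 := by
  rw [xi_eq_rpow one_pos, Real.one_rpow]

lemma moment_eq_betaMoment {α₀ : ℝ} (h₀ : -1 < α₀) (h₁ : -1 < α₁) (h₂ : -1 < α₂) :
    moment α₀ α₁ α₂ = betaMoment (expo α₁ α₂) (α₀ + 1) := by
  funext k l
  have hl := expo_pos h₁ h₂ l
  rw [betaMoment, ← integral_rpow_mul_one_sub_rpow (by positivity) (by linarith), moment]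
  refine intervalIntegral.integral_congr_ae (Eventually.of_forall fun x hx => ?_)
  rw [Set.uIoc_of_le zero_le_one] at hx
  rw [xi_eq_rpow hx.1, add_sub_cancel_right, add_sub_right_comm, Real.rpow_add hx.1,
    Real.rpow_natCast, mul_comm (x ^ k)]

end

end JacobiPineiro

end

theorem mainTheorem4 (α₀ α₁ α₂ : ℝ) (h₀ : -1 < α₀) (h₁ : -1 < α₁) (h₂ : -1 < α₂)
    (hne : ∀ k : ℤ, α₁ - α₂ ≠ k) (hlt : |α₁ - α₂| < 1) :
    (α₀ ≤ 0 →
      JacobiPineiro.IsRecurrent (JacobiPineiro.hatH α₀ α₁ α₂) ∧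
      JacobiPineiro.IsRecurrent (JacobiPineiro.checkH α₀ α₁ α₂)) ∧
    (0 < α₀ →
      JacobiPineiro.IsTransient (JacobiPineiro.hatH α₀ α₁ α₂) ∧
      JacobiPineiro.IsTransient (JacobiPineiro.checkH α₀ α₁ α₂)) := by
  have ha : 0 < α₀ + 1 := by linarith
  have hpos := JacobiPineiro.expo_pos h₁ h₂
  have hshift := JacobiPineiro.expo_add_two (α₁ := α₁) (α₂ := α₂)
  have hinj := JacobiPineiro.expo_injective hne
  have h01 : |JacobiPineiro.expo α₁ α₂ 0 - JacobiPineiro.expo α₁ α₂ 1| < 1 := by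
    simpa [JacobiPineiro.expo] using hlt
  have hmom := JacobiPineiro.moment_eq_betaMoment h₀ h₁ h₂
  have hII : ∀ n, JacobiPineiro.typeII α₀ α₁ α₂ n 1
      = JacobiPineiro.typeIIOne (JacobiPineiro.expo α₁ α₂) (α₀ + 1) n := fun n => by
    simp only [JacobiPineiro.typeII, hmom, one_pow]
    rfl
  have hI : ∀ n, JacobiPineiro.typeI α₀ α₁ α₂ n 1
      = JacobiPineiro.typeIOne (JacobiPineiro.expo α₁ α₂) (α₀ + 1) n := fun n => by
    simp only [JacobiPineiro.typeI, hmom, JacobiPineiro.xi_one]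
    rfl
  obtain ⟨hr, ht⟩ := JacobiPineiro.recurrent_transient_of_chain ha hpos hshift hinj h01
    (JacobiPineiro.hatChain ha hpos hshift hinj h01 (JacobiPineiro.hatH α₀ α₁ α₂) fun n m => by
      rw [JacobiPineiro.hatH, hII, hII, hmom])
  obtain ⟨cr, ct⟩ := JacobiPineiro.recurrent_transient_of_chain ha hpos hshift hinj h01
    (JacobiPineiro.checkChain ha hpos hshift hinj h01 (JacobiPineiro.checkH α₀ α₁ α₂) fun n m => by
      rw [JacobiPineiro.checkH, hI, hI, hmom])
  exact ⟨fun h => ⟨hr (by linarith), cr (by linarith)⟩,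
    fun h => ⟨ht (by linarith), ct (by linarith)⟩⟩
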